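/- Let $G$ be a finite weighted undirected multigraph with $n$ vertices (loops and parallel edges allowed) whose edge weights are strictly positive reals. Let $L=(\ell_{ij})$ be its Laplacian matrix: for $i\ne j$, $-\ell_{ij}$ is the total weight of the edges joining $i$ and $j$, and $\ell_{ii}=-\sum_{j\ne i}\ell_{ij}$. Let $v$ be the number of connected components of $G$, and let $V_i$ be the vertex set of the component containing $i$. A spanning rooted forest of $G$ is an acyclic subgraph with the same vertex set as $G$ together with one marked vertex (root) in each of its components. Let $\mathcal F_k$ be the set of spanning rooted forests of $G$ with exactly $k$ edges (so $\mathcal F_{-1}=\varnothing$), and let $\mathcal F^{ij}_k\subseteq\mathcal F_k$ be the subset of those forests in which $j$ belongs to the tree rooted at $i$. For a set $\mathcal G$ of rooted forests, let $\varepsilon(\mathcal G)$ be the sum over its members of the product of their edge weights (the empty product is $1$, the empty sum is $0$). Let $Q_k$ be the matrix with entries $\varepsilon(\mathcal F^{ij}_k)$, and let $\bar J$ be the matrix with entries $\bar J_{ij}=1/|V_i|$ if $j\in V_i$ and $\bar J_{ij}=0$ otherwise. Then $\varepsilon(\mathcal F_{n-v})>0$, and the Moore–Penrose inverse $L^+=(\ell^+_{ij})$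 of $L$, that is, the unique matrix such that $LL^+$ and $L^+L$ are Hermitian, $LL^+L=L$ and $L^+LL^+=L^+$, has the entries $$\ell^+_{ij}=\begin{cases}\dfrac{\varepsilon(\mathcal F^{ij}_{n-v-1})-\frac{1}{|V_i|}\,\varepsilon(\mathcal F_{n-v-1})}{\varepsilon(\mathcal F_{n-v})},&\text{if } j\in V_i,\\[2ex]0,&\text{otherwise.}\end{cases}$$ Equivalently, $$L^+=\frac{1}{\varepsilon(\mathcal F_{n-v})}\left(Q_{n-v-1}-\varepsilon(\mathcal F_{n-v-1})\,\bar J\right).$$ -/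

import Mathlib

/-- A finite (when `V` and `E` are finite) weighted undirected multigraph with vertex set `V` and
edge set `E`. Every edge has an unordered pair of ends; parallel edges and loops are allowed.
The weights are strictly positive. -/
structure WeightedMultigraph (V E : Type*) where
  /-- the two ends of an edge -/
  ends : E → Sym2 V
  /-- the weight of an edge -/
  weight : E → ℝ
  weight_pos : ∀ e, 0 < weight e

namespace WeightedMultigraph

variable {V E : Type*}

/-- The adjacency relation of the spanning subgraph with edge set `S`, as a simple graph on `V`:
two distinct vertices are adjacent when some edge of `S` joins them. It has the same connected
components as that subgraph. -/
def adjGraph (G : WeightedMultigraph V E) (S : Set E) : SimpleGraph V :=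
  SimpleGraph.fromEdgeSet (G.ends '' S)

/-- The number `v` of connected components of `G`. -/
noncomputable def numComponents (G : WeightedMultigraph V E) : ℕ :=
  Nat.card (G.adjGraph Set.univ).ConnectedComponent

/-- The set `V_i` of the vertices of the component of `G` that contains `i`. -/
def componentOf (G : WeightedMultigraph V E) (i : V) : Set V :=
  ((G.adjGraph Set.univ).connectedComponentMk i).supp

/-- The edge set `S` contains no cycle. A cycle consists of distinct vertices `x 0, …, x m` and
distinct edges `c 0, …, c m`, where `c t` joins `x t` to `x (t + 1)`, indices being taken
modulo `m + 1` (this is the addition of `Fin (m + 1)`). Thus a loop is a cycle (`m = 0`) and so is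
a pair of parallel edges (`m = 1`). -/
def IsAcyclic (G : WeightedMultigraph V E) (S : Set E) : Prop :=
  ¬ ∃ (m : ℕ) (x : Fin (m + 1) → V) (c : Fin (m + 1) → E),
      Function.Injective x ∧ Function.Injective c ∧
      ∀ t, c t ∈ S ∧ G.ends (c t) = s(x t, x (t + 1))

/-- The pair `(S, R)` of an edge set and a set of roots is a spanning rooted forest of `G`:
the spanning subgraph with edge set `S` is acyclic, and each of its components contains exactly
one root. -/
def IsSpanningRootedForest (G : WeightedMultigraph V E) (F : Finset E × Finset V) : Prop :=
  G.IsAcyclic (F.1 : Set E) ∧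
    ∀ T : (G.adjGraph (F.1 : Set E)).ConnectedComponent, ∃! r : V, r ∈ F.2 ∧ r ∈ T.supp

/-- In the rooted forest `F = (S, R)`, the vertex `j` belongs to the tree rooted at `i`. -/
def InTreeRootedAt (G : WeightedMultigraph V E) (F : Finset E × Finset V) (i j : V) : Prop :=
  i ∈ F.2 ∧ (G.adjGraph (F.1 : Set E)).Reachable i j

section Finite

variable [Fintype V] [Fintype E]

open Classical in
/-- The set `F_k` of the spanning rooted forests of `G` with exactly `k` edges. The number `k` is
an integer, so that `F_k` is empty for `k < 0`. -/
noncomputable def forests (G : WeightedMultigraph V E) (k : ℤ) :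
    Finset (Finset E × Finset V) :=
  {F | G.IsSpanningRootedForest F ∧ (F.1.card : ℤ) = k}

open Classical in
/-- The set `F^{ij}_k` of those forests of `F_k` in which `j` belongs to the tree rooted at `i`. -/
noncomputable def forestsAt (G : WeightedMultigraph V E) (k : ℤ) (i j : V) :
    Finset (Finset E × Finset V) :=
  {F ∈ G.forests k | G.InTreeRootedAt F i j}

/-- The total weight of a set of rooted forests: the sum over its members of the product of the
edge weights. -/
def totalWeight (G : WeightedMultigraph V E) (𝓕 : Finset (Finset E × Finset V)) : ℝ :=
  ∑ F ∈ 𝓕, ∏ e ∈ F.1, G.weight e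

/-- The matrix `Q_k` with entries `ε(F^{ij}_k)`. -/
noncomputable def forestMatrix (G : WeightedMultigraph V E) (k : ℤ) : Matrix V V ℝ :=
  Matrix.of fun i j => G.totalWeight (G.forestsAt k i j)

open Classical in
/-- The total weight `ε_{ij}` of the edges that join `i` and `j`. -/
noncomputable def edgeWeight (G : WeightedMultigraph V E) (i j : V) : ℝ :=
  ∑ e : E with G.ends e = s(i, j), G.weight e

open Classical in
/-- The Laplacian matrix of `G`: the entry `(i, j)` with `i ≠ j` is minus the total weight of the
edges joining `i` and `j`, and every row sums to zero. -/
noncomputable def laplacian (G : WeightedMultigraph V E) : Matrix V V ℝ :=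
  Matrix.of fun i j =>
    if i = j then ∑ k : V with k ≠ i, G.edgeWeight i k else - G.edgeWeight i j

open Classical in
/-- The matrix `J̄` with entry `1 / |V_i|` at `(i, j)` if `j ∈ V_i`, and `0` otherwise. -/
noncomputable def barJ (G : WeightedMultigraph V E) : Matrix V V ℝ :=
  Matrix.of fun i j => if j ∈ G.componentOf i then 1 / ((G.componentOf i).ncard : ℝ) else 0

end Finite

end WeightedMultigraph

/-- `B` is the Moore–Penrose generalized inverse of the rectangular matrix `A`. -/
structure IsMoorePenroseInverse {𝕜 m n : Type*} [RCLike 𝕜] [Fintype m] [Fintype n]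
    (A : Matrix m n 𝕜) (B : Matrix n m 𝕜) : Prop where
  isHermitian_mul_left : (A * B).IsHermitian
  isHermitian_mul_right : (B * A).IsHermitian
  mul_mul_self : A * B * A = A
  self_mul_mul : B * A * B = B

/-!
The argument rests on the recurrence `Q_{k+1} = ε(F_{k+1}) I - Q_k L` (`forestMatrix_mul_laplacian`).
Once it is known, every `Q_k` is a polynomial in `L`, hence symmetric and commuting with `L`. There
are no forests with more than `n - v` edges, and in a forest with exactly `n - v` edges the trees
span the components of `G`; together with symmetry this gives `Q_{n-v} = ε(F_{n-v}) J̄`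
(`forestMatrix_max`). The recurrence for `k = n - v` then says `J̄ L = 0`, and for `k = n - v - 1` it
says `Q_{n-v-1} L = ε(F_{n-v}) (I - J̄)`. With `Q_k J̄ = ε(F_k) J̄` the four Moore–Penrose conditions
follow for the proposed matrix, whose products with `L` are both equal to `I - J̄`.

The recurrence is proved entry by entry. For `i ≠ j` the entry `(i, j)` of `Q_k L` is a sum over the
edges at `j` (`sum_mul_laplacian`). A forest in which `j` is not a root arises in exactly one way from a
forest with one edge less in which `j` is a root, by hanging the tree of `j` on another tree by an
edge at `j` (`graft`, `sum_forests_eq_sum_graft`). The contributions of the forests in which `j` is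
not a root become a double sum over the edges at `j` whose summand is antisymmetric
(`sum_darts_sum_forests_eq_zero`), and what is left cancels with `Q_{k+1}`. The diagonal entries
follow since the columns of `Q_k` sum to `ε(F_k)`.

Rooted forests are handled through the criterion `isSpanningRootedForest_iff`: a pair `(S, R)` is a
spanning rooted forest if and only if every vertex is joined in `S` to a vertex of `R` and
`|S| + |R| = n`. Acyclicity enters only there, and all later changes of a forest reduce to the effect
of one edge on reachability (`reach_insert_iff`).
-/

namespace WeightedMultigraph

variable {V E : Type*}

/-! ### Reachability in the spanning subgraph of an edge set -/

/-- The vertices `u` and `w` are joined by a walk with edges in `S`. -/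
abbrev Reach (G : WeightedMultigraph V E) (S : Set E) (u w : V) : Prop :=
  (G.adjGraph S).Reachable u w

theorem reach_of_ends (G : WeightedMultigraph V E) {S : Set E} {e : E} (he : e ∈ S) {a b : V}
    (h : G.ends e = s(a, b)) : G.Reach S a b := by
  by_cases hab : a = b
  · subst hab; exact SimpleGraph.Reachable.refl _
  · refine SimpleGraph.Adj.reachable ?_
    rw [adjGraph, SimpleGraph.fromEdgeSet_adj]
    exact ⟨⟨e, he, h⟩, hab⟩

theorem exists_edge_of_adj (G : WeightedMultigraph V E) {S : Set E} {a b : V}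
    (h : (G.adjGraph S).Adj a b) : ∃ e ∈ S, G.ends e = s(a, b) := by
  rw [adjGraph, SimpleGraph.fromEdgeSet_adj] at h
  exact h.1

theorem Reach.mono {G : WeightedMultigraph V E} {S T : Set E} (hST : S ⊆ T) {u w : V}
    (h : G.Reach S u w) : G.Reach T u w :=
  SimpleGraph.Reachable.mono (SimpleGraph.fromEdgeSet_mono (Set.image_mono hST)) h

/-- A relation that is reflexive, transitive and holds along the edges of `S` holds between any
two vertices that are joined in `S`. -/
theorem Reach.induction {G : WeightedMultigraph V E} {S : Set E} {r : V → V → Prop}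
    (hr : ∀ u, r u u) (ht : ∀ u w x, r u w → r w x → r u x)
    (he : ∀ e ∈ S, ∀ a b, G.ends e = s(a, b) → r a b) {u w : V} (h : G.Reach S u w) : r u w := by
  obtain ⟨p⟩ := h
  induction p with
  | nil => exact hr _
  | cons hadj _ ih =>
    obtain ⟨e, heS, hee⟩ := G.exists_edge_of_adj hadj
    exact ht _ _ _ (he e heS _ _ hee) ih

/-- How reachability changes when an edge is added. -/
theorem reach_insert_iff (G : WeightedMultigraph V E) {S : Set E} {e : E} {a b : V}
    (h : G.ends e = s(a, b)) {u w : V} :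
    G.Reach (insert e S) u w ↔
      G.Reach S u w ∨ (G.Reach S u a ∧ G.Reach S b w) ∨ (G.Reach S u b ∧ G.Reach S a w) := by
  constructor
  · rintro ⟨p⟩
    induction p with
    | nil => exact Or.inl (SimpleGraph.Reachable.refl _)
    | @cons x y z hadj _ ih =>
      obtain ⟨f, hf, hfe⟩ := G.exists_edge_of_adj hadj
      rcases hf with rfl | hf
      · rw [h, Sym2.eq_iff] at hfe
        rcases hfe with ⟨rfl, rfl⟩ | ⟨rfl, rfl⟩
        · rcases ih with ih | ⟨-, ih⟩ | ⟨-, ih⟩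
          · exact Or.inr (Or.inl ⟨.refl _, ih⟩)
          · exact Or.inr (Or.inl ⟨.refl _, ih⟩)
          · exact Or.inl ih
        · rcases ih with ih | ⟨-, ih⟩ | ⟨-, ih⟩
          · exact Or.inr (Or.inr ⟨.refl _, ih⟩)
          · exact Or.inl ih
          · exact Or.inr (Or.inr ⟨.refl _, ih⟩)
      · have hxy := G.reach_of_ends hf hfe
        rcases ih with ih | ⟨i1, ih⟩ | ⟨i1, ih⟩
        · exact Or.inl (hxy.trans ih)
        · exact Or.inr (Or.inl ⟨hxy.trans i1, ih⟩)
        · exact Or.inr (Or.inr ⟨hxy.trans i1, ih⟩)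
  · have hab : G.Reach (insert e S) a b := G.reach_of_ends (Set.mem_insert _ _) h
    have hm : ∀ {x y}, G.Reach S x y → G.Reach (insert e S) x y :=
      fun hxy => Reach.mono (Set.subset_insert _ _) hxy
    rintro (h1 | ⟨h1, h2⟩ | ⟨h1, h2⟩)
    · exact hm h1
    · exact (hm h1).trans (hab.trans (hm h2))
    · exact (hm h1).trans (hab.symm.trans (hm h2))

theorem reach_empty_iff (G : WeightedMultigraph V E) {u w : V} : G.Reach ∅ u w ↔ u = w := by
  constructor
  · exact Reach.induction (fun _ => rfl) (fun _ _ _ => Eq.trans) (fun _ h => absurd h id)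
  · rintro rfl; exact .refl _

/-- A path from `j` to `r` leaves `j` along its first edge `f` and does not use `f` again. -/
theorem Reach.exists_first_edge {G : WeightedMultigraph V E} {S : Set E} {j r : V} (hne : j ≠ r)
    (h : G.Reach S j r) : ∃ f ∈ S, ∃ m, G.ends f = s(j, m) ∧ G.Reach (S \ {f}) m r := by
  classical
  obtain ⟨p, hp⟩ := h.exists_isPath
  cases p with
  | nil => exact absurd rfl hne
  | @cons _ m _ hadj q =>
    obtain ⟨f, hf, hfe⟩ := G.exists_edge_of_adj hadj
    refine ⟨f, hf, m, hfe, ?_⟩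
    rw [SimpleGraph.Walk.cons_isPath_iff] at hp
    refine ⟨q.transfer _ fun d hd => ?_⟩
    have hjd : j ∉ d := fun hj => hp.2 (q.mem_support_of_mem_edges hd hj)
    induction d with | _ a b =>
    have hab := q.adj_of_mem_edges hd
    obtain ⟨g, hg, hge⟩ := G.exists_edge_of_adj hab
    rw [SimpleGraph.mem_edgeSet, adjGraph, SimpleGraph.fromEdgeSet_adj]
    refine ⟨⟨g, ⟨hg, ?_⟩, hge⟩, hab.ne⟩
    rintro rfl
    rw [hfe] at hge
    exact hjd (hge ▸ Sym2.mem_mk_left j m)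

/-! ### Cycles and bridges -/

/-- Every edge of an acyclic set is a bridge: a path that joins its ends without it would close up
to a cycle. -/
theorem IsAcyclic.not_reach {G : WeightedMultigraph V E} {S : Set E} (hS : G.IsAcyclic S) {e : E}
    (he : e ∈ S) {a b : V} (h : G.ends e = s(a, b)) : ¬ G.Reach (S \ {e}) a b := by
  classical
  intro hr
  obtain ⟨p, hp⟩ := hr.exists_isPath
  have hedge : ∀ t : ℕ, t < p.length →
      ∃ f ∈ S \ {e}, G.ends f = s(p.getVert t, p.getVert (t + 1)) :=
    fun t ht => G.exists_edge_of_adj (p.adj_getVert_succ ht)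
  have : Nonempty E := ⟨e⟩
  choose! c hc using hedge
  have hinj : ∀ {s t : ℕ}, s ≤ p.length → t ≤ p.length → p.getVert s = p.getVert t → s = t :=
    fun hs ht hst => hp.getVert_injOn hs ht hst
  refine hS ⟨p.length, fun t => p.getVert t, fun t => if (t : ℕ) < p.length then c t else e,
    ?_, ?_, ?_⟩
  · intro s t hst
    exact Fin.ext (hinj (Nat.lt_succ_iff.1 s.2) (Nat.lt_succ_iff.1 t.2) hst)
  · intro s t hst
    have hs := s.2
    have ht := t.2
    apply Fin.ext
    simp only at hst
    split_ifs at hst with h1 h2 h2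
    · have h3 := (hc _ h1).2
      rw [hst, (hc _ h2).2, Sym2.eq_iff] at h3
      rcases h3 with ⟨h3, -⟩ | ⟨h3, h4⟩
      · exact (hinj (by omega) (by omega) h3).symm
      · have := hinj (by omega) (by omega) h3
        have := hinj (by omega) (by omega) h4
        omega
    · exact absurd hst (hc _ h1).1.2
    · exact absurd hst.symm (hc _ h2).1.2
    · omega
  · intro t
    have ht := t.2
    by_cases h1 : (t : ℕ) < p.length
    · have h2 : ((t + 1 : Fin (p.length + 1)) : ℕ) = t + 1 := by
        rw [Fin.val_add_one_of_lt]
        rw [Fin.lt_def, Fin.val_last]; exact h1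
      simp only [h1, if_true, h2]
      exact ⟨(hc _ h1).1.1, (hc _ h1).2⟩
    · have h2 : t = Fin.last _ := Fin.ext (by rw [Fin.val_last]; omega)
      subst h2
      simp [he, h, Sym2.eq_swap]

/-- A set of edges that contains a cycle has an edge that is not a bridge. -/
theorem exists_reach_of_not_isAcyclic {G : WeightedMultigraph V E} {S : Set E}
    (hS : ¬ G.IsAcyclic S) :
    ∃ e ∈ S, ∃ a b, G.ends e = s(a, b) ∧ G.Reach (S \ {e}) a b := by
  rw [IsAcyclic, not_not] at hS
  obtain ⟨m, x, c, -, hc, h⟩ := hS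
  refine ⟨c (Fin.last m), (h _).1, x (Fin.last m), x 0, ?_, SimpleGraph.Reachable.symm ?_⟩
  · rw [(h _).2, Fin.last_add_one]
  · suffices ∀ t : Fin (m + 1), G.Reach (S \ {c (Fin.last m)}) (x 0) (x t) from this _
    intro t
    induction t using Fin.induction with
    | zero => exact .refl _
    | succ t ih =>
      refine ih.trans (G.reach_of_ends (S := S \ {c (Fin.last m)}) (e := c t.castSucc)
        ⟨(h _).1, fun he => ?_⟩ ?_)
      · exact t.castSucc_lt_last.ne (hc he)
      · rw [(h _).2, Fin.coeSucc_eq_succ]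

/-! ### Rooted forests by counting -/

/-- Every vertex is joined in `S` to a vertex of `R`. -/
def Covers (G : WeightedMultigraph V E) (S : Set E) (R : Set V) : Prop :=
  ∀ u, ∃ r ∈ R, G.Reach S u r

section Finite

variable [Fintype V]

open Classical

/-- A covering pair needs at least as many edges and roots as there are vertices: an edge can be
traded for a further root. -/
theorem Covers.card_le {G : WeightedMultigraph V E} (S : Finset E) {R : Finset V}
    (h : G.Covers S R) : Fintype.card V ≤ S.card + R.card := by
  induction S using Finset.induction_on generalizing R with
  | empty =>
    have hR : R = Finset.univ := by
      refine Finset.eq_univ_of_forall fun u => ?_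
      obtain ⟨r, hr, hur⟩ := h u
      rw [Finset.coe_empty, reach_empty_iff] at hur
      exact hur ▸ hr
    simp [hR]
  | insert e S he ih =>
    obtain ⟨a, b, hab⟩ : ∃ a b, G.ends e = s(a, b) := ⟨_, _, (Quot.out_eq (G.ends e)).symm⟩
    rw [Finset.coe_insert] at h
    have key : ∃ x, G.Covers S (insert x R : Finset V) := by
      obtain ⟨r, hr, har⟩ := h a
      rw [G.reach_insert_iff hab] at har
      -- One end of `e` reaches `R` without `e`; the other end is the new root.
      have aux : ∀ x y, G.ends e = s(x, y) → G.Reach S x r →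
          G.Covers S (insert y R : Finset V) := by
        intro x y hxy hx u
        obtain ⟨r', hr', hur⟩ := h u
        rw [G.reach_insert_iff hxy] at hur
        rcases hur with h1 | ⟨h1, -⟩ | ⟨h1, -⟩
        · exact ⟨r', by simpa using Or.inr hr', h1⟩
        · exact ⟨r, by simpa using Or.inr hr, h1.trans hx⟩
        · exact ⟨y, by simp, h1⟩
      rcases har with h1 | ⟨-, h1⟩ | ⟨-, h1⟩
      · exact ⟨b, aux a b hab h1⟩
      · exact ⟨a, aux b a (by rw [hab, Sym2.eq_swap]) h1⟩
      · exact ⟨b, aux a b hab h1⟩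
    obtain ⟨x, hx⟩ := key
    have h1 := ih hx
    have h2 := Finset.card_insert_le x R
    rw [Finset.card_insert_of_notMem he]
    omega

/-- An acyclic edge set and a set of pairwise disconnected vertices have together at most as many
elements as there are vertices. -/
theorem card_add_card_le_of_isAcyclic {G : WeightedMultigraph V E} (S : Finset E) {R : Finset V}
    (hS : G.IsAcyclic (S : Set E)) (hR : ∀ r ∈ R, ∀ r' ∈ R, G.Reach (S : Set E) r r' → r = r') :
    S.card + R.card ≤ Fintype.card V := by
  induction S using Finset.induction_on generalizing R with
  | empty => simpa using R.card_le_univ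
  | insert e S he ih =>
    obtain ⟨a, b, hab⟩ : ∃ a b, G.ends e = s(a, b) := ⟨_, _, (Quot.out_eq (G.ends e)).symm⟩
    rw [Finset.coe_insert] at hS hR
    have hbr : ¬ G.Reach (S : Set E) a b := by
      have := hS.not_reach (Set.mem_insert _ _) hab
      rwa [Set.insert_sdiff_self_of_notMem (by simpa using he)] at this
    have hS' : G.IsAcyclic (S : Set E) := fun ⟨m, x, c, h1, h2, h3⟩ =>
      hS ⟨m, x, c, h1, h2, fun t => ⟨Set.mem_insert_of_mem _ (h3 t).1, (h3 t).2⟩⟩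
    -- The edge `e` is traded for the root `x`.
    have aux : ∀ x, (∀ r ∈ R, ¬ G.Reach (S : Set E) r x) →
        S.card + (R.card + 1) ≤ Fintype.card V := by
      intro x hx
      have hxR : x ∉ R := fun h => hx x h (.refl _)
      rw [← Finset.card_insert_of_notMem hxR]
      refine ih hS' fun r hr r' hr' hrr => ?_
      rw [Finset.mem_insert] at hr hr'
      rcases hr with rfl | hr <;> rcases hr' with rfl | hr'
      · rfl
      · exact absurd hrr.symm (hx _ hr')
      · exact absurd hrr (hx _ hr)
      · exact hR r hr r' hr' (Reach.mono (Set.subset_insert _ _) hrr)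
    rw [Finset.card_insert_of_notMem he]
    suffices S.card + (R.card + 1) ≤ Fintype.card V by omega
    by_cases h1 : ∃ r ∈ R, G.Reach (S : Set E) r a
    · obtain ⟨r, hr, hra⟩ := h1
      refine aux b fun r' hr' hrb => ?_
      have := hR r hr r' hr' ((G.reach_insert_iff hab).2 (Or.inr (Or.inl ⟨hra, hrb.symm⟩)))
      subst this
      exact hbr (hra.symm.trans hrb)
    · push Not at h1
      exact aux a h1

/-- A spanning rooted forest is a covering pair with as many edges and roots together as there are
vertices. -/
theorem isSpanningRootedForest_iff {G : WeightedMultigraph V E} {F : Finset E × Finset V} :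
    G.IsSpanningRootedForest F ↔
      G.Covers F.1 F.2 ∧ F.1.card + F.2.card = Fintype.card V := by
  constructor
  · rintro ⟨h1, h2⟩
    have hc : G.Covers F.1 F.2 := fun u => by
      obtain ⟨r, ⟨hr, hu⟩, -⟩ := h2 ((G.adjGraph F.1).connectedComponentMk u)
      exact ⟨r, hr, (SimpleGraph.ConnectedComponent.exact hu).symm⟩
    refine ⟨hc, le_antisymm (card_add_card_le_of_isAcyclic _ h1 fun r hr r' hr' h => ?_)
      (hc.card_le)⟩
    exact (h2 ((G.adjGraph F.1).connectedComponentMk r)).unique ⟨hr, rfl⟩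
      ⟨hr', SimpleGraph.ConnectedComponent.sound h.symm⟩
  · rintro ⟨h1, h2⟩
    refine ⟨?_, fun T => ?_⟩
    · by_contra hS
      obtain ⟨e, he, a, b, hab, hr⟩ := exists_reach_of_not_isAcyclic hS
      have hc : G.Covers (F.1.erase e : Finset E) F.2 := fun u => by
        obtain ⟨r, hr', hur⟩ := h1 u
        refine ⟨r, hr', ?_⟩
        rw [Finset.coe_erase]
        rw [← Set.insert_sdiff_self_of_mem he, G.reach_insert_iff hab] at hur
        rcases hur with h | ⟨h, h'⟩ | ⟨h, h'⟩
        · exact h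
        · exact h.trans (hr.trans h')
        · exact h.trans (hr.symm.trans h')
      have h3 := hc.card_le
      have h4 := Finset.card_erase_lt_of_mem he
      omega
    · induction T using SimpleGraph.ConnectedComponent.ind with | _ u =>
      obtain ⟨r, hr, hur⟩ := h1 u
      refine ⟨r, ⟨hr, SimpleGraph.ConnectedComponent.sound hur.symm⟩, ?_⟩
      rintro r' ⟨hr', hur'⟩
      have hrr' : G.Reach (F.1 : Set E) r' r :=
        (SimpleGraph.ConnectedComponent.exact hur').trans hur
      by_contra hne
      -- A second root in the component is superfluous.
      have hc : G.Covers F.1 (F.2.erase r' : Finset V) := fun w => by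
        obtain ⟨q, hq, hwq⟩ := h1 w
        by_cases hqr : q = r'
        · subst hqr
          exact ⟨r, Finset.mem_erase.2 ⟨fun h => hne h.symm, hr⟩, hwq.trans hrr'⟩
        · exact ⟨q, Finset.mem_erase.2 ⟨hqr, hq⟩, hwq⟩
      have h3 := hc.card_le
      have h4 := Finset.card_erase_lt_of_mem hr'
      omega

end Finite

end WeightedMultigraph

namespace WeightedMultigraph

variable {V E : Type*} {G : WeightedMultigraph V E}

section

open Classical

/-! ### Moving one edge at a vertex -/

theorem IsSpanningRootedForest.root_unique {F : Finset E × Finset V}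
    (hF : G.IsSpanningRootedForest F) {r r' : V} (hr : r ∈ F.2) (hr' : r' ∈ F.2)
    (h : G.Reach (F.1 : Set E) r r') : r = r' :=
  (hF.2 ((G.adjGraph F.1).connectedComponentMk r)).unique ⟨hr, rfl⟩
    ⟨hr', SimpleGraph.ConnectedComponent.sound h.symm⟩

theorem IsSpanningRootedForest.treeRoot_unique {F : Finset E × Finset V}
    (hF : G.IsSpanningRootedForest F) {r r' u : V} (h : G.InTreeRootedAt F r u)
    (h' : G.InTreeRootedAt F r' u) : r = r' :=
  hF.root_unique h.1 h'.1 (h.2.trans h'.2.symm)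

theorem notMem_of_not_inTreeRootedAt {F : Finset E × Finset V}
    {e : E} {j m : V} (hj : j ∈ F.2) (he : G.ends e = s(j, m))
    (hm : ¬ G.InTreeRootedAt F j m) : e ∉ F.1 :=
  fun h => hm ⟨hj, G.reach_of_ends h he⟩

variable [Fintype V]

theorem IsSpanningRootedForest.covers {F : Finset E × Finset V}
    (hF : G.IsSpanningRootedForest F) : G.Covers F.1 F.2 :=
  (isSpanningRootedForest_iff.1 hF).1

theorem IsSpanningRootedForest.card_add_card {F : Finset E × Finset V}
    (hF : G.IsSpanningRootedForest F) : F.1.card + F.2.card = Fintype.card V :=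
  (isSpanningRootedForest_iff.1 hF).2

theorem IsSpanningRootedForest.exists_treeRoot {F : Finset E × Finset V}
    (hF : G.IsSpanningRootedForest F) (u : V) : ∃ r, G.InTreeRootedAt F r u := by
  obtain ⟨r, hr, h⟩ := hF.covers u
  exact ⟨r, hr, h.symm⟩

/-- The rooted forest `F`, in which `j` is a root, is hung by the edge `e` at `j` on another of its
trees; `j` is a root no longer. -/
noncomputable def graft (F : Finset E × Finset V) (e : E) (j : V) : Finset E × Finset V :=
  (insert e F.1, F.2.erase j)

theorem IsSpanningRootedForest.graft {F : Finset E × Finset V} (hF : G.IsSpanningRootedForest F)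
    {e : E} {j m : V} (hj : j ∈ F.2) (he : G.ends e = s(j, m))
    (hm : ¬ G.InTreeRootedAt F j m) : G.IsSpanningRootedForest (graft F e j) := by
  rw [isSpanningRootedForest_iff]
  refine ⟨fun u => ?_, ?_⟩
  · obtain ⟨q, hq, hmq⟩ := hF.covers m
    have hqj : q ≠ j := by
      rintro rfl
      exact hm ⟨hj, hmq.symm⟩
    obtain ⟨r, hr, hur⟩ := hF.covers u
    simp only [WeightedMultigraph.graft, Finset.coe_insert]
    by_cases hrj : r = j
    · subst hrj
      exact ⟨q, Finset.mem_erase.2 ⟨hqj, hq⟩,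
        (G.reach_insert_iff he).2 (Or.inr (Or.inl ⟨hur, hmq⟩))⟩
    · exact ⟨r, Finset.mem_erase.2 ⟨hrj, hr⟩, (G.reach_insert_iff he).2 (Or.inl hur)⟩
  · have h1 := hF.card_add_card
    have h2 := Finset.card_pos.2 ⟨j, hj⟩
    simp only [WeightedMultigraph.graft]
    rw [Finset.card_insert_of_notMem (notMem_of_not_inTreeRootedAt hj he hm),
      Finset.card_erase_of_mem hj]
    omega

/-- The trees of a grafted forest: the tree rooted at `j` has joined the tree of `m`. -/
theorem IsSpanningRootedForest.inTreeRootedAt_graft_iff {F : Finset E × Finset V}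
    (hF : G.IsSpanningRootedForest F) {e : E} {j m : V} (hj : j ∈ F.2) (he : G.ends e = s(j, m))
    {i u : V} (hij : i ≠ j) :
    G.InTreeRootedAt (WeightedMultigraph.graft F e j) i u ↔
      G.InTreeRootedAt F i u ∨ (G.InTreeRootedAt F j u ∧ G.InTreeRootedAt F i m) := by
  simp only [InTreeRootedAt, WeightedMultigraph.graft, Finset.coe_insert, Finset.mem_erase]
  have key := G.reach_insert_iff (S := (F.1 : Set E)) he (u := i) (w := u)
  have h1 : i ∈ F.2 → ¬ G.Reach (F.1 : Set E) i j := fun hi h => hij (hF.root_unique hi hj h)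
  unfold Reach at *
  tauto

/-- Every rooted forest in which `j` is not a root arises by grafting at `j`. -/
theorem IsSpanningRootedForest.exists_graft {F : Finset E × Finset V}
    (hF : G.IsSpanningRootedForest F) {j : V} (hj : j ∉ F.2) :
    ∃ F' : Finset E × Finset V, ∃ e m, G.IsSpanningRootedForest F' ∧ j ∈ F'.2 ∧
      G.ends e = s(j, m) ∧ ¬ G.InTreeRootedAt F' j m ∧ WeightedMultigraph.graft F' e j = F := by
  obtain ⟨r, hr, hjr⟩ := hF.covers j
  obtain ⟨f, hf, m, hfe, hmr⟩ := hjr.exists_first_edge (by rintro rfl; exact hj hr)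
  rw [Finset.mem_coe] at hf
  have hcard := hF.card_add_card
  have hpos := Finset.card_pos.2 ⟨f, hf⟩
  have hins : insert f ((F.1 : Set E) \ {f}) = F.1 := Set.insert_sdiff_self_of_mem hf
  refine ⟨(F.1.erase f, insert j F.2), f, m, ?_, by simp, hfe, ?_, ?_⟩
  · rw [isSpanningRootedForest_iff]
    refine ⟨fun u => ?_, ?_⟩
    · obtain ⟨q, hq, huq⟩ := hF.covers u
      rw [← hins, G.reach_insert_iff hfe] at huq
      simp only [Finset.coe_erase]
      rcases huq with h | ⟨h, -⟩ | ⟨h, -⟩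
      · exact ⟨q, Finset.mem_insert_of_mem hq, h⟩
      · exact ⟨j, Finset.mem_insert_self _ _, h⟩
      · exact ⟨r, Finset.mem_insert_of_mem hr, h.trans hmr⟩
    · simp only
      rw [Finset.card_insert_of_notMem hj, Finset.card_erase_of_mem hf]
      omega
  · -- Otherwise `j` would still be joined to `r`, and the edge `f` would be superfluous.
    rintro ⟨-, hjm⟩
    simp only [Finset.coe_erase] at hjm
    have hc : G.Covers (F.1.erase f : Finset E) F.2 := fun u => by
      obtain ⟨q, hq, huq⟩ := hF.covers u
      rw [← hins, G.reach_insert_iff hfe] at huq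
      simp only [Finset.coe_erase]
      rcases huq with h | ⟨h, -⟩ | ⟨h, -⟩
      · exact ⟨q, hq, h⟩
      · exact ⟨r, hr, h.trans (SimpleGraph.Reachable.trans hjm hmr)⟩
      · exact ⟨r, hr, h.trans hmr⟩
    have h1 := hc.card_le
    rw [Finset.card_erase_of_mem hf] at h1
    omega
  · ext1
    · exact Finset.insert_erase hf
    · exact Finset.erase_insert hj

/-- The edge along which a forest was grafted can be recovered: it is the first edge on the way
from `j` to its new root. -/
theorem IsSpanningRootedForest.edge_eq_of_graft_eq {F F' : Finset E × Finset V}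
    (hF : G.IsSpanningRootedForest F) {e e' : E} {j m m' : V}
    (hj : j ∈ F.2) (hj' : j ∈ F'.2) (hF' : G.IsSpanningRootedForest F')
    (he : G.ends e = s(j, m)) (he' : G.ends e' = s(j, m'))
    (hm' : ¬ G.InTreeRootedAt F' j m')
    (h : WeightedMultigraph.graft F e j = WeightedMultigraph.graft F' e' j) : e = e' := by
  by_contra hne
  have hS : insert e F.1 = insert e' F'.1 := congrArg Prod.fst h
  have hR : F.2.erase j = F'.2.erase j := congrArg Prod.snd h
  have he'F : e' ∈ F.1 := (Finset.mem_insert.1 (hS ▸ Finset.mem_insert_self e' F'.1)).resolve_left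
    (fun h => hne h.symm)
  obtain ⟨r, hr, hmr⟩ := hF'.covers m'
  have hrj : r ≠ j := by
    rintro rfl
    exact hm' ⟨hj', hmr.symm⟩
  have hrF : r ∈ F.2 := Finset.mem_of_mem_erase (hR ▸ Finset.mem_erase.2 ⟨hrj, hr⟩)
  have hjm' : G.Reach (F.1 : Set E) j m' := G.reach_of_ends he'F he'
  have hsub : (F'.1 : Set E) \ {e} ⊆ F.1 := fun x hx =>
    (Finset.mem_insert.1 (hS ▸ Finset.mem_insert_of_mem hx.1)).resolve_left hx.2
  have heF' : e ∈ F'.1 :=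
    (Finset.mem_insert.1 (hS ▸ Finset.mem_insert_self e F.1)).resolve_left hne
  -- The way from `m'` to `r` in `F'` avoids `j`, hence also `e`, so that it lies in `F` as well.
  have hFr : G.Reach (F.1 : Set E) m' r := by
    rw [← Set.insert_sdiff_self_of_mem (Finset.mem_coe.2 heF'), G.reach_insert_iff he] at hmr
    rcases hmr with h1 | ⟨h1, -⟩ | ⟨-, h1⟩
    · exact h1.mono hsub
    · exact absurd ⟨hj', (h1.mono Set.sdiff_subset).symm⟩ hm'
    · exact absurd (hF'.root_unique hj' hr (h1.mono Set.sdiff_subset)).symm hrj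
  exact hrj (hF.root_unique hrF hj (hjm'.trans hFr).symm)

end

end WeightedMultigraph

namespace WeightedMultigraph

variable {V E : Type*} {G : WeightedMultigraph V E}

section

open Classical

/-! ### The recurrence for the forest matrices -/

/-- The indicator of `j` belonging to the tree of `F` rooted at `i`. -/
noncomputable def treeInd (G : WeightedMultigraph V E) (F : Finset E × Finset V) (i j : V) : ℝ :=
  if G.InTreeRootedAt F i j then 1 else 0

/-- The product of the edge weights of `F`. -/
noncomputable def forestWeight (G : WeightedMultigraph V E) (F : Finset E × Finset V) : ℝ :=
  ∏ e ∈ F.1, G.weight e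

theorem forestWeight_pos (F : Finset E × Finset V) : 0 < G.forestWeight F :=
  Finset.prod_pos fun e _ => G.weight_pos e

theorem treeInd_mul_treeInd {F : Finset E × Finset V} (hF : G.IsSpanningRootedForest F) {i j : V}
    (hij : i ≠ j) (u : V) : G.treeInd F i u * G.treeInd F j u = 0 := by
  unfold treeInd
  split_ifs with h1 h2
  · exact absurd (hF.treeRoot_unique h1 h2) hij
  all_goals simp

theorem treeInd_root {F : Finset E × Finset V} (hF : G.IsSpanningRootedForest F) {j : V}
    (hj : j ∈ F.2) (i : V) : G.treeInd F i j = if i = j then 1 else 0 := by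
  unfold treeInd
  refine if_congr ⟨fun h => hF.root_unique h.1 hj h.2, ?_⟩ rfl rfl
  rintro rfl
  exact ⟨hj, .refl _⟩

section Finite

variable [Fintype V]

theorem IsSpanningRootedForest.sum_treeInd {F : Finset E × Finset V}
    (hF : G.IsSpanningRootedForest F) (j : V) : ∑ i, G.treeInd F i j = 1 := by
  obtain ⟨r, hr⟩ := hF.exists_treeRoot j
  rw [Finset.sum_eq_single r]
  · simp [treeInd, hr]
  · intro i _ hi
    exact if_neg fun h => hi (hF.treeRoot_unique h hr)
  · simp

theorem treeInd_graft {F : Finset E × Finset V} (hF : G.IsSpanningRootedForest F) {e : E}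
    {i j m : V} (hj : j ∈ F.2) (he : G.ends e = s(j, m)) (hij : i ≠ j) (u : V) :
    G.treeInd (graft F e j) i u = G.treeInd F i u + G.treeInd F j u * G.treeInd F i m := by
  have h := hF.inTreeRootedAt_graft_iff hj he (u := u) hij
  have h' : G.InTreeRootedAt F i u → ¬ G.InTreeRootedAt F j u :=
    fun h1 h2 => hij (hF.treeRoot_unique h1 h2)
  unfold treeInd
  by_cases h1 : G.InTreeRootedAt F i u <;> by_cases h2 : G.InTreeRootedAt F j u <;>
    by_cases h3 : G.InTreeRootedAt F i m <;> simp_all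

variable [Fintype E]

theorem mem_forests {k : ℤ} {F : Finset E × Finset V} :
    F ∈ G.forests k ↔ G.IsSpanningRootedForest F ∧ (F.1.card : ℤ) = k := by
  simp [forests]

theorem forestMatrix_apply (k : ℤ) (i j : V) :
    G.forestMatrix k i j = ∑ F ∈ G.forests k, G.forestWeight F * G.treeInd F i j := by
  simp only [forestMatrix, Matrix.of_apply, totalWeight, forestsAt, treeInd, forestWeight,
    Finset.sum_filter, mul_ite, mul_one, mul_zero]

/-- The columns of `Q_k` sum to `ε(F_k)`, as every vertex belongs to exactly one tree. -/
theorem sum_forestMatrix (k : ℤ) (j : V) :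
    ∑ i, G.forestMatrix k i j = G.totalWeight (G.forests k) := by
  simp only [forestMatrix_apply, totalWeight]
  rw [Finset.sum_comm]
  refine Finset.sum_congr rfl fun F hF => ?_
  rw [← Finset.mul_sum, (mem_forests.1 hF).1.sum_treeInd, mul_one, forestWeight]

/-- The edges at `j`, each with its other end, which is `j` itself for a loop. -/
noncomputable def darts (G : WeightedMultigraph V E) (j : V) : Finset (V × E) :=
  {d | G.ends d.2 = s(j, d.1)}

theorem mem_darts {j : V} {d : V × E} : d ∈ G.darts j ↔ G.ends d.2 = s(j, d.1) := by
  simp [darts]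

/-- The row vector `x L`, edge by edge; loops contribute nothing. -/
theorem sum_mul_laplacian (x : V → ℝ) (j : V) :
    ∑ m, x m * G.laplacian m j = ∑ d ∈ G.darts j, G.weight d.2 * (x j - x d.1) := by
  have h1 : ∑ d ∈ G.darts j, G.weight d.2 * (x j - x d.1)
      = ∑ m, G.edgeWeight j m * (x j - x m) := by
    rw [darts, Finset.sum_filter, Fintype.sum_prod_type]
    refine Finset.sum_congr rfl fun m _ => ?_
    rw [edgeWeight, Finset.sum_mul, ← Finset.sum_filter]
  have h2 : ∀ m, G.edgeWeight j m * (x j - x m)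
      = if m ≠ j then G.edgeWeight j m * (x j - x m) else 0 := by
    intro m
    split_ifs with h
    · rfl
    · rw [not_not.1 h, sub_self, mul_zero]
  rw [h1, Finset.sum_congr rfl fun m _ => h2 m, ← Finset.sum_filter]
  simp only [mul_sub, Finset.sum_sub_distrib]
  rw [← Finset.sum_mul, ← Finset.add_sum_erase _ _ (Finset.mem_univ j)]
  have h3 : ∀ m ∈ Finset.univ.erase j, x m * G.laplacian m j = -(G.edgeWeight j m * x m) := by
    intro m hm
    rw [laplacian, Matrix.of_apply, if_neg (Finset.ne_of_mem_erase hm)]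
    simp only [edgeWeight, Sym2.eq_swap (a := m)]
    ring
  rw [Finset.sum_congr rfl h3, Finset.sum_neg_distrib, laplacian, Matrix.of_apply, if_pos rfl,
    ← Finset.filter_ne']
  ring

/-- Summation over the forests in which `j` is not a root, by means of the forests with one edge
less in which `j` is a root. -/
theorem sum_forests_eq_sum_graft (k : ℤ) (j : V) (φ : Finset E × Finset V → ℝ) :
    ∑ F ∈ G.forests (k + 1) with j ∉ F.2, G.forestWeight F * φ F =
      ∑ F ∈ G.forests k with j ∈ F.2, G.forestWeight F *
        ∑ d ∈ G.darts j with ¬ G.InTreeRootedAt F j d.1, G.weight d.2 * φ (graft F d.2 j) := by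
  simp only [Finset.mul_sum]
  rw [Finset.sum_sigma']
  symm
  refine Finset.sum_bij (fun p _ => graft p.1 p.2.2 j) ?_ ?_ ?_ ?_
  · rintro ⟨F, m, e⟩ h
    simp only [Finset.mem_sigma, Finset.mem_filter, mem_forests, mem_darts] at h ⊢
    obtain ⟨⟨⟨hF, hk⟩, hj⟩, he, hm⟩ := h
    refine ⟨⟨hF.graft hj he hm, ?_⟩, by simp [graft]⟩
    rw [graft, Finset.card_insert_of_notMem (notMem_of_not_inTreeRootedAt hj he hm)]
    push_cast
    rw [hk]
  · rintro ⟨F, m, e⟩ h ⟨F', m', e'⟩ h' heq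
    simp only [Finset.mem_sigma, Finset.mem_filter, mem_forests, mem_darts] at h h' heq
    obtain ⟨⟨⟨hF, hk⟩, hj⟩, he, hm⟩ := h
    obtain ⟨⟨⟨hF', hk'⟩, hj'⟩, he', hm'⟩ := h'
    have hee := hF.edge_eq_of_graft_eq hj hj' hF' he he' hm' heq
    subst hee
    have hmm : m = m' := Sym2.congr_right.1 (he.symm.trans he')
    subst hmm
    have h1 : F.1 = F'.1 := by
      rw [← Finset.erase_insert (notMem_of_not_inTreeRootedAt hj he hm),
        ← Finset.erase_insert (notMem_of_not_inTreeRootedAt hj' he' hm')]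
      exact congrArg (Finset.erase · e) (congrArg Prod.fst heq)
    have h2 : F.2 = F'.2 := by
      rw [← Finset.insert_erase hj, ← Finset.insert_erase hj']
      exact congrArg (insert j ·) (congrArg Prod.snd heq)
    rw [Prod.ext h1 h2]
  · intro F hF
    simp only [Finset.mem_filter, mem_forests] at hF
    obtain ⟨⟨hF, hk⟩, hj⟩ := hF
    obtain ⟨F', e, m, hF', hj', he, hm, rfl⟩ := hF.exists_graft hj
    refine ⟨⟨F', m, e⟩, ?_, rfl⟩
    simp only [Finset.mem_sigma, Finset.mem_filter, mem_forests, mem_darts]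
    refine ⟨⟨⟨hF', ?_⟩, hj'⟩, he, hm⟩
    rw [graft, Finset.card_insert_of_notMem (notMem_of_not_inTreeRootedAt hj' he hm)] at hk
    push_cast at hk
    linarith
  · rintro ⟨F, m, e⟩ h
    simp only [Finset.mem_sigma, Finset.mem_filter, mem_forests, mem_darts] at h ⊢
    obtain ⟨⟨⟨hF, hk⟩, hj⟩, he, hm⟩ := h
    rw [forestWeight, forestWeight, graft,
      Finset.prod_insert (notMem_of_not_inTreeRootedAt hj he hm)]
    ring

theorem sum_darts_filter (F : Finset E × Finset V) (j : V) (f : V × E → ℝ) :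
    ∑ d ∈ G.darts j with ¬ G.InTreeRootedAt F j d.1, f d =
      ∑ d ∈ G.darts j, (1 - G.treeInd F j d.1) * f d := by
  rw [Finset.sum_filter]
  refine Finset.sum_congr rfl fun d _ => ?_
  unfold treeInd
  split_ifs <;> simp

/-- Swapping the edge by which `j` hangs in its forest for another edge at `j` shows that, in the
weighted count over the forests in which `j` is not a root, the neighbours of `j` lie in the tree
rooted at `i` exactly as often as `j` itself does. -/
theorem sum_darts_sum_forests_eq_zero (k : ℤ) {i j : V} (hij : i ≠ j) :
    ∑ d ∈ G.darts j, G.weight d.2 * ∑ F ∈ G.forests (k + 1) with j ∉ F.2,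
      G.forestWeight F * (G.treeInd F i j - G.treeInd F i d.1) = 0 := by
  simp only [Finset.mul_sum]
  rw [Finset.sum_comm]
  have h1 : ∀ F : Finset E × Finset V, ∑ d ∈ G.darts j,
      G.weight d.2 * (G.forestWeight F * (G.treeInd F i j - G.treeInd F i d.1)) =
      G.forestWeight F * ∑ d ∈ G.darts j, G.weight d.2 * (G.treeInd F i j - G.treeInd F i d.1) := by
    intro F
    rw [Finset.mul_sum]
    exact Finset.sum_congr rfl fun d _ => by ring
  rw [Finset.sum_congr rfl fun F _ => h1 F, sum_forests_eq_sum_graft k j]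
  refine Finset.sum_eq_zero fun F hF => ?_
  simp only [Finset.mem_filter, mem_forests] at hF
  obtain ⟨⟨hF, -⟩, hj⟩ := hF
  rw [sum_darts_filter]
  have hjj : G.treeInd F j j = 1 := by rw [treeInd_root hF hj, if_pos rfl]
  have hji : G.treeInd F i j = 0 := by rw [treeInd_root hF hj, if_neg hij]
  -- The summand is antisymmetric in the two edges `d` and `d'` at `j`.
  have key : ∀ d' ∈ G.darts j, (1 - G.treeInd F j d'.1) * (G.weight d'.2 *
      ∑ d ∈ G.darts j, G.weight d.2 *
        (G.treeInd (graft F d'.2 j) i j - G.treeInd (graft F d'.2 j) i d.1)) =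
      ∑ d ∈ G.darts j, G.weight d'.2 * G.weight d.2 *
        (G.treeInd F i d'.1 * (1 - G.treeInd F j d.1)
          - G.treeInd F i d.1 * (1 - G.treeInd F j d'.1)) := by
    intro d' hd'
    rw [Finset.mul_sum, Finset.mul_sum]
    refine Finset.sum_congr rfl fun d _ => ?_
    rw [treeInd_graft hF hj (mem_darts.1 hd') hij, treeInd_graft hF hj (mem_darts.1 hd') hij,
      hjj, hji]
    have h0 := treeInd_mul_treeInd hF hij d'.1
    linear_combination
      (G.weight d'.2 * G.weight d.2 * (G.treeInd F j d.1 - 1)) * h0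
  rw [Finset.sum_congr rfl key]
  refine mul_eq_zero_of_right _ (self_eq_neg.1 ?_)
  conv_lhs => rw [Finset.sum_comm]
  simp only [← Finset.sum_neg_distrib]
  exact Finset.sum_congr rfl fun d _ => Finset.sum_congr rfl fun d' _ => by ring

theorem forestMatrix_recurrence_of_ne (k : ℤ) {i j : V} (hij : i ≠ j) :
    (G.forestMatrix k * G.laplacian) i j + G.forestMatrix (k + 1) i j = 0 := by
  -- Both terms reduce to sums over the forests in which `j` is a root, and these cancel.
  have h1 : (G.forestMatrix k * G.laplacian) i j =
      -∑ F ∈ G.forests k with j ∈ F.2, G.forestWeight F *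
        ∑ d ∈ G.darts j, G.weight d.2 * G.treeInd F i d.1 := by
    have h0 := G.sum_darts_sum_forests_eq_zero (k - 1) hij
    rw [sub_add_cancel] at h0
    rw [Matrix.mul_apply, sum_mul_laplacian]
    have h2 : ∀ d ∈ G.darts j,
        G.weight d.2 * (G.forestMatrix k i j - G.forestMatrix k i d.1) =
        -∑ F ∈ G.forests k with j ∈ F.2, G.forestWeight F * (G.weight d.2 * G.treeInd F i d.1) +
        G.weight d.2 * ∑ F ∈ G.forests k with j ∉ F.2,
          G.forestWeight F * (G.treeInd F i j - G.treeInd F i d.1) := by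
      intro d _
      have h3 : ∀ F ∈ (G.forests k).filter (fun F => j ∈ F.2),
          G.forestWeight F * (G.weight d.2 * G.treeInd F i d.1) =
          -(G.weight d.2 * (G.forestWeight F * (G.treeInd F i j - G.treeInd F i d.1))) := by
        intro F hF
        rw [Finset.mem_filter, mem_forests] at hF
        rw [treeInd_root hF.1.1 hF.2, if_neg hij]
        ring
      rw [Finset.sum_congr rfl h3, Finset.sum_neg_distrib, neg_neg, ← Finset.mul_sum, ← mul_add,
        Finset.sum_filter_add_sum_filter_not, forestMatrix_apply, forestMatrix_apply,
        ← Finset.sum_sub_distrib]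
      simp only [mul_sub]
    rw [Finset.sum_congr rfl h2, Finset.sum_add_distrib, h0, add_zero, Finset.sum_neg_distrib,
      Finset.sum_comm]
    simp only [Finset.mul_sum]
  have h2 : G.forestMatrix (k + 1) i j =
      ∑ F ∈ G.forests k with j ∈ F.2, G.forestWeight F *
        ∑ d ∈ G.darts j, G.weight d.2 * G.treeInd F i d.1 := by
    rw [forestMatrix_apply, ← Finset.sum_filter_add_sum_filter_not _ (fun F => j ∈ F.2),
      Finset.sum_eq_zero, zero_add, sum_forests_eq_sum_graft k j (fun F => G.treeInd F i j)]
    · refine Finset.sum_congr rfl fun F hF => ?_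
      rw [Finset.mem_filter, mem_forests] at hF
      rw [sum_darts_filter]
      refine congrArg _ (Finset.sum_congr rfl fun d hd => ?_)
      rw [treeInd_graft hF.1.1 hF.2 (mem_darts.1 hd) hij, treeInd_root hF.1.1 hF.2,
        treeInd_root hF.1.1 hF.2, if_neg hij, if_pos rfl]
      linear_combination (-G.weight d.2) * treeInd_mul_treeInd hF.1.1 hij d.1
    · intro F hF
      rw [Finset.mem_filter, mem_forests] at hF
      rw [treeInd_root hF.1.1 hF.2, if_neg hij, mul_zero]
  rw [h1, h2, neg_add_cancel]

/-- The recurrence `Q_{k+1} = ε(F_{k+1}) I - Q_k L`. Its diagonal follows from the other entries,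
since both sides have the same column sums. -/
theorem forestMatrix_mul_laplacian (k : ℤ) :
    G.forestMatrix k * G.laplacian =
      G.totalWeight (G.forests (k + 1)) • (1 : Matrix V V ℝ) - G.forestMatrix (k + 1) := by
  ext i j
  rw [Matrix.sub_apply, Matrix.smul_apply, smul_eq_mul]
  by_cases hij : i = j
  · subst hij
    have h1 : ∑ m, ((G.forestMatrix k * G.laplacian) m i + G.forestMatrix (k + 1) m i) =
        G.totalWeight (G.forests (k + 1)) := by
      rw [Finset.sum_add_distrib, sum_forestMatrix]
      simp only [Matrix.mul_apply]
      rw [Finset.sum_comm]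
      simp only [← Finset.sum_mul, sum_forestMatrix]
      rw [sum_mul_laplacian (fun _ => G.totalWeight (G.forests k))]
      simp
    rw [Finset.sum_eq_single i (fun m _ hm => forestMatrix_recurrence_of_ne k hm) (by simp)] at h1
    rw [Matrix.one_apply_eq]
    linarith
  · rw [Matrix.one_apply_ne hij]
    linarith [G.forestMatrix_recurrence_of_ne k hij]

end Finite

end

end WeightedMultigraph

namespace WeightedMultigraph

variable {V E : Type*} {G : WeightedMultigraph V E}

section

open Classical

/-! ### Components of the graph -/

theorem mem_componentOf {i j : V} : j ∈ G.componentOf i ↔ G.Reach Set.univ i j := by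
  rw [componentOf, SimpleGraph.ConnectedComponent.mem_supp_iff, SimpleGraph.ConnectedComponent.eq]
  exact ⟨fun h => h.symm, fun h => h.symm⟩

theorem componentOf_eq {i j : V} (h : j ∈ G.componentOf i) : G.componentOf j = G.componentOf i := by
  rw [componentOf, componentOf]
  exact congrArg _ (SimpleGraph.ConnectedComponent.sound (mem_componentOf.1 h).symm)

theorem barJ_apply (i j : V) : G.barJ i j =
    if j ∈ G.componentOf i then 1 / ((G.componentOf i).ncard : ℝ) else 0 := by
  rw [barJ, Matrix.of_apply]

theorem mem_componentOf_comm {i j : V} : j ∈ G.componentOf i ↔ i ∈ G.componentOf j := by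
  rw [mem_componentOf, mem_componentOf]
  exact ⟨fun h => h.symm, fun h => h.symm⟩

theorem barJ_isSymm : G.barJ.IsSymm := by
  refine Matrix.IsSymm.ext fun i j => ?_
  rw [barJ_apply, barJ_apply]
  by_cases h : j ∈ G.componentOf i
  · rw [if_pos h, if_pos (mem_componentOf_comm.1 h), componentOf_eq h]
  · rw [if_neg h, if_neg fun h' => h (mem_componentOf_comm.1 h')]

/-- The component of `G` that contains a given root. -/
def rootComponent (G : WeightedMultigraph V E) (R : Finset V) (r : R) :
    (G.adjGraph Set.univ).ConnectedComponent :=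
  (G.adjGraph Set.univ).connectedComponentMk r

theorem Covers.rootComponent_surjective {S : Set E} {R : Finset V} (h : G.Covers S R) :
    Function.Surjective (G.rootComponent R) := by
  intro T
  induction T using SimpleGraph.ConnectedComponent.ind with | _ u =>
  obtain ⟨r, hr, hur⟩ := h u
  exact ⟨⟨r, hr⟩, SimpleGraph.ConnectedComponent.sound (hur.mono (Set.subset_univ _)).symm⟩

section Finite

variable [Fintype V]

theorem IsSpanningRootedForest.numComponents_le {F : Finset E × Finset V}
    (hF : G.IsSpanningRootedForest F) : G.numComponents ≤ F.2.card := by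
  have h := Nat.card_le_card_of_surjective _ hF.covers.rootComponent_surjective
  rwa [← numComponents, Nat.card_eq_fintype_card, Fintype.card_coe] at h

/-- In a forest with as few roots as there are components, the trees are these components. -/
theorem IsSpanningRootedForest.reach_of_card_eq {F : Finset E × Finset V}
    (hF : G.IsSpanningRootedForest F) (h : F.2.card = G.numComponents) {u w : V}
    (huw : G.Reach Set.univ u w) : G.Reach (F.1 : Set E) u w := by
  have hb : Function.Bijective (G.rootComponent F.2) :=
    (Nat.bijective_iff_surjective_and_card _).2 ⟨hF.covers.rootComponent_surjective, by
      rw [← numComponents, ← h]; simp⟩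
  obtain ⟨r, hr, hur⟩ := hF.covers u
  obtain ⟨q, hq, hwq⟩ := hF.covers w
  have hrq : (⟨r, hr⟩ : {x // x ∈ F.2}) = ⟨q, hq⟩ :=
    hb.1 (SimpleGraph.ConnectedComponent.sound
      (((hur.mono (Set.subset_univ _)).symm.trans huw).trans (hwq.mono (Set.subset_univ _))))
  obtain rfl : r = q := congrArg Subtype.val hrq
  exact hur.trans hwq.symm

variable [Fintype E]

/-! ### Symmetry -/

theorem laplacian_isSymm : G.laplacian.IsSymm := by
  refine Matrix.IsSymm.ext fun i j => ?_
  by_cases hij : i = j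
  · rw [hij]
  · simp only [laplacian, Matrix.of_apply, if_neg hij, if_neg (Ne.symm hij), edgeWeight,
      Sym2.eq_swap (a := i)]

theorem forests_eq_empty_of_neg {k : ℤ} (hk : k < 0) : G.forests k = ∅ := by
  refine Finset.eq_empty_of_forall_notMem fun F hF => ?_
  have := (mem_forests.1 hF).2
  omega

/-- By the recurrence every `Q_k` is a polynomial in the symmetric matrix `L`. -/
theorem forestMatrix_isSymm_and_commute (k : ℤ) :
    (G.forestMatrix k).IsSymm ∧ Commute G.laplacian (G.forestMatrix k) := by
  have h0 : ∀ k < 0, G.forestMatrix k = 0 := by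
    intro k hk
    ext i j
    simp [forestMatrix_apply, forests_eq_empty_of_neg hk]
  have h1 : ∀ m : ℕ, (G.forestMatrix ((m : ℤ) - 1)).IsSymm ∧
      Commute G.laplacian (G.forestMatrix ((m : ℤ) - 1)) := by
    intro m
    induction m with
    | zero => rw [h0 _ (by simp)]; exact ⟨Matrix.isSymm_zero, Commute.zero_right _⟩
    | succ m ih =>
      obtain ⟨ih1, ih2⟩ := ih
      have h2 := G.forestMatrix_mul_laplacian ((m : ℤ) - 1)
      have h3 : G.forestMatrix (((m + 1 : ℕ) : ℤ) - 1) =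
          G.totalWeight (G.forests ((m : ℤ) - 1 + 1)) • (1 : Matrix V V ℝ) -
            G.forestMatrix ((m : ℤ) - 1) * G.laplacian := by
        rw [h2, sub_sub_cancel]
        congr 1
        push_cast
        ring
      rw [h3]
      constructor
      · refine Matrix.IsSymm.sub (Matrix.isSymm_one.smul _) ?_
        rw [Matrix.IsSymm, Matrix.transpose_mul, ih1.eq, laplacian_isSymm.eq, ih2.eq]
      · exact ((Commute.one_right _).smul_right _).sub_right (ih2.mul_right (Commute.refl _))
  rcases lt_or_ge k 0 with hk | hk
  · rw [h0 k hk]; exact ⟨Matrix.isSymm_zero, Commute.zero_right _⟩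
  · have := h1 (k + 1).toNat
    rwa [Int.toNat_of_nonneg (by omega), add_sub_cancel_right] at this

/-! ### Maximal forests -/

/-- A forest with the greatest number of edges has one tree in each component of `G`. -/
theorem exists_isSpanningRootedForest_card_eq (G : WeightedMultigraph V E) :
    ∃ F, G.IsSpanningRootedForest F ∧ F.2.card = G.numComponents := by
  have hne : (Finset.univ.filter G.IsSpanningRootedForest).Nonempty := by
    refine ⟨(∅, Finset.univ), ?_⟩
    rw [Finset.mem_filter, isSpanningRootedForest_iff]
    exact ⟨Finset.mem_univ _, fun u => ⟨u, by simp, .refl _⟩, by simp⟩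
  obtain ⟨F, hF, hmax⟩ := Finset.exists_max_image _ (fun F => F.1.card) hne
  rw [Finset.mem_filter] at hF
  replace hF := hF.2
  refine ⟨F, hF, le_antisymm ?_ hF.numComponents_le⟩
  -- The ends of every edge lie in the same tree, as the edge could be added otherwise.
  have hedge : ∀ e ∈ (Set.univ : Set E), ∀ a b, G.ends e = s(a, b) → G.Reach (F.1 : Set E) a b := by
    intro e _ a b he
    by_contra hab
    obtain ⟨r, hr, har⟩ := hF.covers a
    obtain ⟨q, hq, hbq⟩ := hF.covers b
    have hqr : q ≠ r := by
      rintro rfl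
      exact hab (har.trans hbq.symm)
    have heF : e ∉ F.1 := fun h => hab (G.reach_of_ends h he)
    have hF' : G.IsSpanningRootedForest (insert e F.1, F.2.erase r) := by
      rw [isSpanningRootedForest_iff]
      refine ⟨fun u => ?_, ?_⟩
      · obtain ⟨p, hp, hup⟩ := hF.covers u
        simp only [Finset.coe_insert]
        by_cases hpr : p = r
        · subst hpr
          exact ⟨q, Finset.mem_erase.2 ⟨hqr, hq⟩,
            (G.reach_insert_iff he).2 (Or.inr (Or.inl ⟨hup.trans har.symm, hbq⟩))⟩
        · exact ⟨p, Finset.mem_erase.2 ⟨hpr, hp⟩, (G.reach_insert_iff he).2 (Or.inl hup)⟩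
      · have h1 := hF.card_add_card
        have h2 := Finset.card_pos.2 ⟨r, hr⟩
        simp only
        rw [Finset.card_insert_of_notMem heF, Finset.card_erase_of_mem hr]
        omega
    have h1 := hmax _ (Finset.mem_filter.2 ⟨Finset.mem_univ _, hF'⟩)
    simp only [Finset.card_insert_of_notMem heF] at h1
    omega
  have hinj : Function.Injective (G.rootComponent F.2) := by
    rintro ⟨r, hr⟩ ⟨q, hq⟩ h
    have h1 : G.Reach Set.univ r q := SimpleGraph.ConnectedComponent.exact h
    refine Subtype.ext (hF.root_unique hr hq ?_)
    exact h1.induction (r := fun a b => G.Reach (F.1 : Set E) a b) (fun _ => .refl _)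
      (fun _ _ _ h h' => h.trans h') hedge
  have := Nat.card_le_card_of_injective _ hinj
  rwa [← numComponents, Nat.card_eq_fintype_card, Fintype.card_coe] at this

theorem totalWeight_forests_pos (G : WeightedMultigraph V E) :
    0 < G.totalWeight (G.forests ((Fintype.card V : ℤ) - G.numComponents)) := by
  obtain ⟨F, hF, h⟩ := G.exists_isSpanningRootedForest_card_eq
  refine Finset.sum_pos (fun F _ => forestWeight_pos F) ⟨F, mem_forests.2 ⟨hF, ?_⟩⟩
  have := hF.card_add_card
  omega

theorem forests_succ_eq_empty (G : WeightedMultigraph V E) :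
    G.forests ((Fintype.card V : ℤ) - G.numComponents + 1) = ∅ := by
  refine Finset.eq_empty_of_forall_notMem fun F hF => ?_
  rw [mem_forests] at hF
  have h1 := hF.1.card_add_card
  have h2 := hF.1.numComponents_le
  have h3 := hF.2
  omega

theorem forestMatrix_eq_zero {k : ℤ} {i j : V} (h : j ∉ G.componentOf i) :
    G.forestMatrix k i j = 0 := by
  rw [forestMatrix_apply]
  refine Finset.sum_eq_zero fun F _ => ?_
  rw [treeInd, if_neg, mul_zero]
  exact fun hF => h (mem_componentOf.2 (Reach.mono (Set.subset_univ _) hF.2))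

theorem forestMatrix_mul_barJ (k : ℤ) :
    G.forestMatrix k * G.barJ = G.totalWeight (G.forests k) • G.barJ := by
  ext i j
  have hs : ∀ m, G.forestMatrix k m i = G.forestMatrix k i m := fun m =>
    (G.forestMatrix_isSymm_and_commute k).1.apply i m
  rw [Matrix.smul_apply, smul_eq_mul, ← sum_forestMatrix k i, Matrix.mul_apply, Finset.sum_mul]
  refine Finset.sum_congr rfl fun m _ => ?_
  rw [hs m]
  by_cases hm : m ∈ G.componentOf i
  · rw [barJ_apply, barJ_apply, componentOf_eq hm]
  · rw [forestMatrix_eq_zero hm, zero_mul, zero_mul]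

/-- In a forest with `n - v` edges the vertices of a component of `G` all have the same root, so
that the rows of `Q_{n-v}` are constant on components; by symmetry so are the columns. -/
theorem forestMatrix_max (G : WeightedMultigraph V E) :
    G.forestMatrix ((Fintype.card V : ℤ) - G.numComponents) =
      G.totalWeight (G.forests ((Fintype.card V : ℤ) - G.numComponents)) • G.barJ := by
  set k := (Fintype.card V : ℤ) - G.numComponents with hk
  have hrow : ∀ i j, j ∈ G.componentOf i → ∀ l, G.forestMatrix k l i = G.forestMatrix k l j := by
    intro i j hij l
    rw [forestMatrix_apply, forestMatrix_apply]
    refine Finset.sum_congr rfl fun F hF => ?_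
    rw [mem_forests] at hF
    have h1 := hF.1.card_add_card
    have h2 := hF.2
    have h3 := hF.1.reach_of_card_eq (by omega) (mem_componentOf.1 hij)
    refine congrArg _ (if_congr ?_ rfl rfl)
    exact ⟨fun h => ⟨h.1, h.2.trans h3⟩, fun h => ⟨h.1, h.2.trans h3.symm⟩⟩
  have hs : ∀ a b, G.forestMatrix k a b = G.forestMatrix k b a := fun a b =>
    (G.forestMatrix_isSymm_and_commute k).1.apply b a
  ext i j
  rw [Matrix.smul_apply, smul_eq_mul, barJ_apply]
  split_ifs with h
  · have hcol : ∀ m, G.forestMatrix k m j =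
        if m ∈ G.componentOf i then G.forestMatrix k i j else 0 := by
      intro m
      split_ifs with hm
      · rw [hs m, hs i, hrow i m hm]
      · rw [hs m]
        refine forestMatrix_eq_zero fun hmj => hm ?_
        rwa [← componentOf_eq h]
    have hsum := G.sum_forestMatrix k j
    rw [Finset.sum_congr rfl fun m _ => hcol m, ← Finset.sum_filter, Finset.sum_const,
      nsmul_eq_mul] at hsum
    have hcard : (Finset.univ.filter fun m => m ∈ G.componentOf i).card
        = (G.componentOf i).ncard := by
      rw [← Set.ncard_coe_finset]
      simp
    have hpos : ((G.componentOf i).ncard : ℝ) ≠ 0 :=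
      Nat.cast_ne_zero.2 (Set.ncard_ne_zero_of_mem h)
    rw [hcard] at hsum
    rw [← hsum]
    field_simp
  · rw [forestMatrix_eq_zero h, mul_zero]

end Finite

end

end WeightedMultigraph

/-! ### The Moore–Penrose inverse -/

theorem IsMoorePenroseInverse.unique {𝕜 m n : Type*} [RCLike 𝕜] [Fintype m] [Fintype n]
    {A : Matrix m n 𝕜} {B C : Matrix n m 𝕜} (hB : IsMoorePenroseInverse A B)
    (hC : IsMoorePenroseInverse A C) : B = C := by
  have h1 : A * B = A * C := by
    have h : A * B = (A * C) * (A * B) := by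
      rw [← Matrix.mul_assoc, hC.mul_mul_self]
    calc A * B = (A * B).conjTranspose := hB.isHermitian_mul_left.eq.symm
      _ = (A * B).conjTranspose * (A * C).conjTranspose := by
        conv_lhs => rw [h]
        rw [Matrix.conjTranspose_mul]
      _ = (A * B) * (A * C) := by rw [hB.isHermitian_mul_left.eq, hC.isHermitian_mul_left.eq]
      _ = A * C := by rw [← Matrix.mul_assoc, hB.mul_mul_self]
  have h2 : B * A = C * A := by
    have h : B * A = (B * A) * (C * A) := by
      rw [Matrix.mul_assoc, ← Matrix.mul_assoc A, hC.mul_mul_self]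
    calc B * A = (B * A).conjTranspose := hB.isHermitian_mul_right.eq.symm
      _ = (C * A).conjTranspose * (B * A).conjTranspose := by
        conv_lhs => rw [h]
        rw [Matrix.conjTranspose_mul]
      _ = (C * A) * (B * A) := by rw [hB.isHermitian_mul_right.eq, hC.isHermitian_mul_right.eq]
      _ = C * A := by rw [Matrix.mul_assoc, ← Matrix.mul_assoc A, hB.mul_mul_self]
  calc B = B * A * B := hB.self_mul_mul.symm
    _ = C * A * C := by rw [h2, Matrix.mul_assoc, h1, Matrix.mul_assoc]
    _ = C := hC.self_mul_mul

namespace WeightedMultigraph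

theorem isMoorePenroseInverse_laplacian {V E : Type*} [Fintype V] [Fintype E]
    (G : WeightedMultigraph V E) {k : ℤ} (hk : k = (Fintype.card V : ℤ) - G.numComponents) :
    IsMoorePenroseInverse G.laplacian ((1 / G.totalWeight (G.forests k)) •
        (G.forestMatrix (k - 1) - G.totalWeight (G.forests (k - 1)) • G.barJ)) := by
  classical
  have hpos : 0 < G.totalWeight (G.forests k) := hk ▸ G.totalWeight_forests_pos
  have hmax : G.forestMatrix k = G.totalWeight (G.forests k) • G.barJ := hk ▸ G.forestMatrix_max
  have hempty : G.forests (k + 1) = ∅ := hk ▸ G.forests_succ_eq_empty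
  set σ := G.totalWeight (G.forests k)
  set τ := G.totalWeight (G.forests (k - 1))
  have hbarJ : G.barJ = (1 / σ) • G.forestMatrix k := by
    rw [hmax, smul_smul, one_div_mul_cancel hpos.ne', one_smul]
  have hJL : G.barJ * G.laplacian = 0 := by
    have h : G.forestMatrix (k + 1) = 0 := by
      ext i j
      simp [forestMatrix_apply, hempty]
    rw [hbarJ, Matrix.smul_mul, forestMatrix_mul_laplacian, h, hempty]
    simp [totalWeight]
  have hLJ : G.laplacian * G.barJ = 0 := by
    rw [← laplacian_isSymm.eq, ← G.barJ_isSymm.eq, ← Matrix.transpose_mul, hJL,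
      Matrix.transpose_zero]
  have hJJ : G.barJ * G.barJ = G.barJ := by
    conv_lhs => rw [hbarJ, Matrix.smul_mul, ← hbarJ]
    rw [forestMatrix_mul_barJ, smul_smul, one_div_mul_cancel hpos.ne', one_smul]
  have hQL : G.forestMatrix (k - 1) * G.laplacian = σ • (1 - G.barJ) := by
    rw [forestMatrix_mul_laplacian, sub_add_cancel, hmax, smul_sub]
  have hLQ : G.laplacian * G.forestMatrix (k - 1) = σ • (1 - G.barJ) := by
    rw [(G.forestMatrix_isSymm_and_commute (k - 1)).2.eq, hQL]
  set B := (1 / σ) • (G.forestMatrix (k - 1) - τ • G.barJ)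
  have hBL : B * G.laplacian = 1 - G.barJ := by
    rw [Matrix.smul_mul, Matrix.sub_mul, Matrix.smul_mul, hJL, hQL, smul_zero, sub_zero, smul_smul,
      one_div_mul_cancel hpos.ne', one_smul]
  have hLB : G.laplacian * B = 1 - G.barJ := by
    rw [Matrix.mul_smul, Matrix.mul_sub, Matrix.mul_smul, hLJ, hLQ, smul_zero, sub_zero, smul_smul,
      one_div_mul_cancel hpos.ne', one_smul]
  have hBJ : B * G.barJ = 0 := by
    rw [Matrix.smul_mul, Matrix.sub_mul, Matrix.smul_mul, hJJ, forestMatrix_mul_barJ, sub_self,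
      smul_zero]
  have hherm : (1 - G.barJ).IsHermitian := by
    rw [Matrix.IsHermitian, Matrix.conjTranspose_eq_transpose_of_trivial, Matrix.transpose_sub,
      Matrix.transpose_one, G.barJ_isSymm.eq]
  refine ⟨?_, ?_, ?_, ?_⟩
  · rwa [hLB]
  · rwa [hBL]
  · rw [hLB, Matrix.sub_mul, Matrix.one_mul, hJL, sub_zero]
  · rw [Matrix.mul_assoc, hLB, Matrix.mul_sub, Matrix.mul_one, hBJ, sub_zero]

end WeightedMultigraph

theorem theorem3 {V E : Type*} [Fintype V] [Fintype E] (G : WeightedMultigraph V E)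
    (n v : ℕ) (hn : n = Fintype.card V) (hv : v = G.numComponents) :
    0 < G.totalWeight (G.forests ((n : ℤ) - v)) ∧
    ∃ Lplus : Matrix V V ℝ,
      IsMoorePenroseInverse G.laplacian Lplus ∧
      (∀ B : Matrix V V ℝ, IsMoorePenroseInverse G.laplacian B → B = Lplus) ∧
      (∀ i j : V, j ∈ G.componentOf i →
        Lplus i j =
          (G.totalWeight (G.forestsAt ((n : ℤ) - v - 1) i j)
              - 1 / ((G.componentOf i).ncard : ℝ) * G.totalWeight (G.forests ((n : ℤ) - v - 1)))
            / G.totalWeight (G.forests ((n : ℤ) - v))) ∧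
      (∀ i j : V, j ∉ G.componentOf i → Lplus i j = 0) ∧
      Lplus = (1 / G.totalWeight (G.forests ((n : ℤ) - v))) •
        (G.forestMatrix ((n : ℤ) - v - 1)
          - G.totalWeight (G.forests ((n : ℤ) - v - 1)) • G.barJ) := by
  subst hn hv
  have hL := G.isMoorePenroseInverse_laplacian rfl
  refine ⟨G.totalWeight_forests_pos, _, hL, fun B hB => hB.unique hL, fun i j hij => ?_,
    fun i j hij => ?_, rfl⟩
  · simp only [Matrix.smul_apply, Matrix.sub_apply, smul_eq_mul, WeightedMultigraph.barJ_apply,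
      if_pos hij, WeightedMultigraph.forestMatrix, Matrix.of_apply]
    ring
  · simp only [Matrix.smul_apply, Matrix.sub_apply, smul_eq_mul, WeightedMultigraph.barJ_apply,
      if_neg hij, WeightedMultigraph.forestMatrix_eq_zero hij]
    ring
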